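/- Let $n\ge 1$. A (convex) polytope in $\mathbb{R}^n$ is a bounded intersection of finitely many closed halfspaces; its faces are the sets of points at which a linear functional attains its maximum over the polytope (the polytope itself included), its vertices are the faces consisting of a single point, and its edges are the one-dimensional faces. Let $\mathcal{T}$ be a locally finite polytopal tiling of $\mathbb{R}^n$, that is, a family of convex polytopes with nonempty interior that covers $\mathbb{R}^n$, whose members have pairwise disjoint interiors, and such that each bounded subset of $\mathbb{R}^n$ meets only finitely many members. Let $G=(V,E)$ be the undirected graph in which $V\subset\mathbb{R}^n$ is the set of all vertices of tiles of $\mathcal{T}$ (vertices of different tiles are identified if they are equal as points of $\mathbb{R}^n$), and two distinct points $x,y\in V$ are joined by an edge of $G$ if and only if the line segment $\overline{xy}$ is an entire edge of some tile of $\mathcal{T}$. Then every connected component of $G$ has infinitely many vertices. -/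

import Mathlib

/-- A (convex) polyhedron in `ℝⁿ`: an intersection of finitely many closed halfspaces
`{x | ⟪a, x⟫ ≤ b}` with `a ≠ 0`. -/
def IsPolyhedron {n : ℕ} (P : Set (EuclideanSpace ℝ (Fin n))) : Prop :=
  ∃ (m : ℕ) (a : Fin m → EuclideanSpace ℝ (Fin n)) (b : Fin m → ℝ),
    (∀ j, a j ≠ 0) ∧ P = {x | ∀ j, inner ℝ (a j) x ≤ b j}

/-- A (convex) polytope: a bounded polyhedron. -/
def IsPolytope {n : ℕ} (P : Set (EuclideanSpace ℝ (Fin n))) : Prop :=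
  IsPolyhedron P ∧ Bornology.IsBounded P

/-- `x` is a vertex of the polytope `P`: the set `{x}` is a face of `P`. Faces are the sets
of maximizers in `P` of linear functionals, that is, Mathlib's exposed subsets. -/
def IsVertexOf {n : ℕ} (P : Set (EuclideanSpace ℝ (Fin n)))
    (x : EuclideanSpace ℝ (Fin n)) : Prop :=
  IsExposed ℝ P {x}

/-- The segment with endpoints `x` and `y` is an entire edge (one-dimensional face) of the
polytope `P`. The polytope itself counts as a face, so for `n = 1` a tile is its own edge. -/
def IsEdgeOf {n : ℕ} (P : Set (EuclideanSpace ℝ (Fin n)))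
    (x y : EuclideanSpace ℝ (Fin n)) : Prop :=
  x ≠ y ∧ IsExposed ℝ P (segment ℝ x y)

/-- A polytopal tiling of `ℝⁿ`: a family of full-dimensional convex polytopes that covers `ℝⁿ`
and whose members have pairwise disjoint interiors. -/
structure IsPolytopalTiling {n : ℕ} {ι : Type*} (T : ι → Set (EuclideanSpace ℝ (Fin n))) :
    Prop where
  polytope : ∀ i, IsPolytope (T i)
  full_dim : ∀ i, (interior (T i)).Nonempty
  covering : ⋃ i, T i = Set.univ
  packing : Pairwise fun i j => Disjoint (interior (T i)) (interior (T j))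

/-- A tiling is locally finite if each bounded set meets only finitely many tiles. -/
def IsLocallyFiniteTiling {n : ℕ} {ι : Type*} (T : ι → Set (EuclideanSpace ℝ (Fin n))) : Prop :=
  ∀ U : Set (EuclideanSpace ℝ (Fin n)), Bornology.IsBounded U →
    {i | (T i ∩ U).Nonempty}.Finite

/-- The set of all vertices of all tiles, as points of `ℝⁿ`. -/
def tilingVertices {n : ℕ} {ι : Type*} (T : ι → Set (EuclideanSpace ℝ (Fin n))) :
    Set (EuclideanSpace ℝ (Fin n)) :=
  {x | ∃ i, IsVertexOf (T i) x}

/-- The graph on the vertices of all tiles in which `x` and `y` are adjacent iff the segment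
from `x` to `y` is an entire edge of some tile. -/
def tilingGraph {n : ℕ} {ι : Type*} (T : ι → Set (EuclideanSpace ℝ (Fin n))) :
    SimpleGraph (tilingVertices T) where
  Adj x y := ∃ i, IsEdgeOf (T i) (x : EuclideanSpace ℝ (Fin n)) (y : EuclideanSpace ℝ (Fin n))
  symm := ⟨fun _ _ ⟨i, hne, he⟩ => ⟨i, hne.symm, by rwa [segment_symm]⟩⟩
  loopless := ⟨fun _ ⟨_, hne, _⟩ => hne rfl⟩

/-! In a finite component, take a vertex `v` farthest from the origin. If some neighbour `y`
satisfies `⟪v, v⟫ ≤ ⟪v, y⟫`, then `‖y‖ ≤ ‖v‖` forces `y = v`, which is absurd. So it is enough that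
at every vertex, for every `u`, some edge does not decrease `⟪u, ·⟫`
(`exists_nondecreasing_tiling_edge`).

Suppose all edges at `v` strictly decrease `⟪u, ·⟫`. The feasible cones at `v` of the tiles
containing `v` tile space, so their indicators sum to 1 a.e. If `v` is a vertex of the tile, the
cone is pointed and lies in `⟪u, ·⟫ < 0` apart from its apex (`exists_nondecreasing_edge`).
Otherwise, as may happen when the tiling is not face-to-face, the cone is invariant along a line,
directed so that `⟪u, ·⟫` does not decrease. Hence the sum `g` of the pointed indicators is a
constant minus periodic functions, while `g` vanishes far out in every direction not decreasing `⟪u,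
·⟫`. Finite differences then give `g = 0` a.e. (`VanishesAbove.ae_eq_zero`), although `g ≥ 1` on a
cone of positive measure. -/

section Polyhedra

/-! ### Feasible cones, vertices and edges of polyhedra given by inequalities. -/

variable {E : Type*} [NormedAddCommGroup E] [InnerProductSpace ℝ E]

/-- The solution set of the linear inequalities `⟪a j, x⟫ ≤ b j`. -/
def halfspaceInter {κ : Type*} (a : κ → E) (b : κ → ℝ) : Set E :=
  {x | ∀ j, inner ℝ (a j) x ≤ b j}

/-- The cone cut out by the homogeneous versions of the inequalities that are tight at `v`. -/
def feasibleCone {κ : Type*} (a : κ → E) (b : κ → ℝ) (v : E) : Set E :=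
  {c | ∀ j, inner ℝ (a j) v = b j → inner ℝ (a j) c ≤ 0}

variable {κ : Type*} {a : κ → E} {b : κ → ℝ} {v : E}

lemma isClosed_halfspaceInter : IsClosed (halfspaceInter a b) := by
  simp only [halfspaceInter, Set.ofPred_forall]
  exact isClosed_iInter fun j => isClosed_le (by fun_prop) (by fun_prop)

lemma convex_feasibleCone : Convex ℝ (feasibleCone a b v) := by
  intro x hx y hy s t hs ht _ j hj
  rw [inner_add_right, inner_smul_right, inner_smul_right]
  nlinarith [mul_nonneg hs (neg_nonneg.2 (hx j hj)), mul_nonneg ht (neg_nonneg.2 (hy j hj))]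

lemma smul_mem_feasibleCone {c : E} (hc : c ∈ feasibleCone a b v) {t : ℝ} (ht : 0 ≤ t) :
    t • c ∈ feasibleCone a b v := by
  intro j hj
  rw [inner_smul_right]
  exact mul_nonpos_of_nonneg_of_nonpos ht (hc j hj)

lemma smul_mem_feasibleCone_iff {c : E} {t : ℝ} (ht : 0 < t) :
    t • c ∈ feasibleCone a b v ↔ c ∈ feasibleCone a b v := by
  refine ⟨fun h => ?_, fun h => smul_mem_feasibleCone h ht.le⟩
  simpa [smul_smul, ht.ne'] using smul_mem_feasibleCone h (inv_nonneg.2 ht.le)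

lemma mem_feasibleCone_of_add_mem {c : E} (hc : v + c ∈ halfspaceInter a b) :
    c ∈ feasibleCone a b v := by
  intro j hj
  have := hc j
  rw [inner_add_right] at this
  linarith

lemma eventually_add_mem_halfspaceInter [Finite κ] (hv : v ∈ halfspaceInter a b) :
    ∀ᶠ c in nhds (0 : E), v + c ∈ halfspaceInter a b ↔ c ∈ feasibleCone a b v := by
  have h : ∀ᶠ c in nhds (0 : E), ∀ j, inner ℝ (a j) v < b j → inner ℝ (a j) (v + c) < b j := by
    refine Filter.eventually_all.2 fun j => ?_
    by_cases hj : inner ℝ (a j) v < b j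
    · have hc : Continuous fun c : E => inner ℝ (a j) (v + c) := by fun_prop
      filter_upwards [hc.continuousAt.eventually_lt (x₀ := 0) continuousAt_const
        (by simpa using hj)] with c hc _ using hc
    · exact Filter.Eventually.of_forall fun c h => absurd h hj
  filter_upwards [h] with c hc
  refine ⟨mem_feasibleCone_of_add_mem, fun hcone j => ?_⟩
  rcases (hv j).lt_or_eq with hj | hj
  · exact (hc j hj).le
  · rw [inner_add_right, hj]
    linarith [hcone j hj]

lemma exists_pos_add_smul_mem [Finite κ] (hv : v ∈ halfspaceInter a b) {c : E}
    (hc : c ∈ feasibleCone a b v) : ∃ t : ℝ, 0 < t ∧ v + t • c ∈ halfspaceInter a b := by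
  have hcont : Filter.Tendsto (fun t : ℝ => t • c) (nhdsWithin 0 (Set.Ioi 0)) (nhds 0) := by
    have : Continuous fun t : ℝ => t • c := by fun_prop
    simpa using (this.tendsto 0).mono_left nhdsWithin_le_nhds
  obtain ⟨t, ht, ht0⟩ := ((hcont.eventually (eventually_add_mem_halfspaceInter hv)).and
    self_mem_nhdsWithin).exists
  exact ⟨t, ht0, ht.2 (smul_mem_feasibleCone hc (le_of_lt ht0))⟩

/-- The sum of the normals in `J` exposes this set: its maximum is the sum of the `b j`, and
equality of the sums forces equality in each term. -/
lemma isExposed_tight [Finite κ] (J : Set κ) :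
    IsExposed ℝ (halfspaceInter a b) {x ∈ halfspaceInter a b | ∀ j ∈ J, inner ℝ (a j) x = b j} := by
  classical
  have := Fintype.ofFinite κ
  rintro ⟨z, hz, hzJ⟩
  have hl : ∀ x, (∑ j ∈ J.toFinset, innerSL ℝ (a j)) x = ∑ j ∈ J.toFinset, inner ℝ (a j) x := by
    intro x; simp
  have hzs : ∑ j ∈ J.toFinset, inner ℝ (a j) z = ∑ j ∈ J.toFinset, b j :=
    Finset.sum_congr rfl fun j hj => hzJ j (by simpa using hj)
  refine ⟨∑ j ∈ J.toFinset, innerSL ℝ (a j), Set.ext fun x => and_congr_right fun hx => ?_⟩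
  simp only [hl]
  constructor
  · intro h y hy
    rw [Finset.sum_congr rfl fun j hj => h j (by simpa using hj)]
    exact Finset.sum_le_sum fun j _ => hy j
  · intro h j hj
    have hsum := (Finset.sum_eq_sum_iff_of_le (s := J.toFinset) fun j _ => hx j).1
      (le_antisymm (Finset.sum_le_sum fun j _ => hx j) (hzs ▸ h z hz))
    exact hsum j (by simpa using hj)

/-- If `w` is orthogonal to all tight normals, a small move along whichever of `w`, `-w` does not
decrease the exposing functional gives another maximizer. Conversely, the tight equations have `v`
as their only solution. -/
lemma isExposed_singleton_iff [Finite κ] (hv : v ∈ halfspaceInter a b) :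
    IsExposed ℝ (halfspaceInter a b) {v} ↔
      ∀ w, (∀ j, inner ℝ (a j) v = b j → inner ℝ (a j) w = 0) → w = 0 := by
  constructor
  · intro h w hw
    obtain ⟨l, hl⟩ := h ⟨v, rfl⟩
    have hmem : ∀ x, x = v ↔ x ∈ halfspaceInter a b ∧ ∀ y ∈ halfspaceInter a b, l y ≤ l x :=
      fun x => Set.ext_iff.1 hl x
    have key : ∀ w, (∀ j, inner ℝ (a j) v = b j → inner ℝ (a j) w = 0) → 0 ≤ l w → w = 0 := by
      intro w hw hlw
      obtain ⟨t, ht, htw⟩ := exists_pos_add_smul_mem hv (c := w) fun j hj => (hw j hj).le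
      have : v + t • w = v := (hmem _).2 ⟨htw, fun y hy => by
        have := ((hmem v).1 rfl).2 y hy
        rw [map_add, map_smul, smul_eq_mul]
        nlinarith [mul_nonneg ht.le hlw]⟩
      simpa [ht.ne'] using this
    rcases le_total 0 (l w) with h0 | h0
    · exact key w hw h0
    · have := key (-w) (fun j hj => by rw [inner_neg_right, hw j hj, neg_zero]) (by simpa using h0)
      simpa using this
  · intro h
    convert isExposed_tight (a := a) (b := b) {j | inner ℝ (a j) v = b j}
    ext x
    constructor
    · rintro rfl
      exact ⟨hv, fun j hj => hj⟩
    · rintro ⟨_, hx⟩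
      refine sub_eq_zero.1 (h (x - v) fun j hj => ?_)
      rw [inner_sub_right, hx j hj, hj, sub_self]

/-- A pointed polyhedral cone that meets the halfspace `0 ≤ ⟪u, ·⟫` outside the origin has an
extreme ray in that halfspace. -/
lemma exists_extreme_ray [FiniteDimensional ℝ E] [Finite κ]
    (hker : ∀ w, (∀ j, inner ℝ (a j) w = 0) → w = 0) {u c : E} (hc : ∀ j, inner ℝ (a j) c ≤ 0)
    (hc0 : c ≠ 0) (huc : 0 ≤ inner ℝ u c) :
    ∃ e : E, e ≠ 0 ∧ (∀ j, inner ℝ (a j) e ≤ 0) ∧ 0 ≤ inner ℝ u e ∧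
      ∀ w, (∀ j, inner ℝ (a j) e = 0 → inner ℝ (a j) w = 0) → ∃ s : ℝ, w = s • e := by
  have := Fintype.ofFinite κ
  have hneg : ∀ c : E, (∀ j, inner ℝ (a j) c ≤ 0) → c ≠ 0 → ∑ j, inner ℝ (a j) c < 0 := by
    intro c hc hc0
    refine lt_of_le_of_ne (Finset.sum_nonpos fun j _ => hc j) fun h => hc0 (hker c fun j => ?_)
    exact (Finset.sum_eq_zero_iff_of_nonpos fun j _ => hc j).1 h j (Finset.mem_univ j)
  -- A slice of the cone, compact because `hker` makes `x ↦ (⟪a j, x⟫)ⱼ` injective and these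
  -- coordinates lie in `[-1, 0]` on `S`.
  set S : Set E := {c | (∀ j, inner ℝ (a j) c ≤ 0) ∧ ∑ j, inner ℝ (a j) c = -1} with hS
  have hScl : IsClosed S := by
    simp only [hS, Set.ofPred_and, Set.ofPred_forall]
    exact (isClosed_iInter fun j => isClosed_le (by fun_prop) (by fun_prop)).inter
      (isClosed_eq (by fun_prop) (by fun_prop))
  have hSb : Bornology.IsBounded S := by
    let A : E →ₗ[ℝ] (κ → ℝ) := LinearMap.pi fun j => (innerSL ℝ (a j)).toLinearMap
    have hA : ∀ x j, A x j = inner ℝ (a j) x := fun x j => rfl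
    obtain ⟨K, -, hK⟩ := A.exists_antilipschitzWith (LinearMap.ker_eq_bot'.2 fun w hw =>
      hker w fun j => by rw [← hA, hw]; rfl)
    refine (hK.isBounded_preimage (Metric.isBounded_Icc (-1) 0)).subset fun x hx => ?_
    refine ⟨fun j => ?_, fun j => hx.1 j⟩
    have h1 : ∑ i, -inner ℝ (a i) x = 1 := by rw [Finset.sum_neg_distrib, hx.2, neg_neg]
    have h2 := Finset.single_le_sum (f := fun i => -inner ℝ (a i) x)
      (fun i _ => neg_nonneg.2 (hx.1 i)) (Finset.mem_univ j)
    rw [h1] at h2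
    change -1 ≤ inner ℝ (a j) x
    linarith
  have hScomp : IsCompact S := Metric.isCompact_of_isClosed_isBounded hScl hSb
  set c' : E := (-∑ j, inner ℝ (a j) c)⁻¹ • c with hc'
  have hpos : 0 < -∑ j, inner ℝ (a j) c := neg_pos.2 (hneg c hc hc0)
  have hc'S : c' ∈ S := by
    refine ⟨fun j => ?_, ?_⟩
    · rw [hc', inner_smul_right]
      exact mul_nonpos_of_nonneg_of_nonpos (inv_nonneg.2 hpos.le) (hc j)
    · simp only [hc', inner_smul_right, ← Finset.mul_sum]
      field_simp
      rw [div_self (neg_pos.1 hpos).ne]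
  have hexp := ContinuousLinearMap.toExposed.isExposed (l := innerSL ℝ u) (A := S)
  obtain ⟨x₀, hx₀, hx₀max⟩ := hScomp.exists_isMaxOn ⟨c', hc'S⟩
    (f := innerSL ℝ u) (by fun_prop)
  -- An extreme point of the face of `S` maximizing `⟪u, ·⟫` is extreme in `S` too.
  obtain ⟨e, he⟩ := (hexp.isCompact hScomp).extremePoints_nonempty ⟨x₀, hx₀, hx₀max⟩
  have heF := he.1
  have heS := hexp.isExtreme.extremePoints_subset_extremePoints he
  obtain ⟨heS1, hext⟩ := mem_extremePoints_iff_left.1 heS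
  have hue : 0 ≤ inner ℝ u e := by
    refine le_trans ?_ (heF.2 c' hc'S)
    rw [innerSL_apply_apply, hc', inner_smul_right]
    exact mul_nonneg (inv_nonneg.2 hpos.le) huc
  refine ⟨e, ?_, heS1.1, hue, fun w hw => ⟨-∑ j, inner ℝ (a j) w, ?_⟩⟩
  · rintro rfl
    have := heS1.2
    simp at this
  -- The multiple of `e` makes `d` parallel to the slice; then `e ± t • d` stay in `S` for small
  -- `t`, and extremality gives `d = 0`.
  set d : E := w - (-∑ j, inner ℝ (a j) w) • e with hd
  have hdsum : ∑ j, inner ℝ (a j) d = 0 := by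
    simp only [hd, inner_sub_right, inner_smul_right, Finset.sum_sub_distrib, ← Finset.mul_sum,
      heS1.2]
    ring
  have hdt : ∀ j, inner ℝ (a j) e = 0 → inner ℝ (a j) d = 0 := by
    intro j hj
    rw [hd, inner_sub_right, inner_smul_right, hw j hj, hj]
    ring
  have hep : e ∈ halfspaceInter a 0 := heS1.1
  have hev : ∀ d, (∀ j, inner ℝ (a j) e = 0 → inner ℝ (a j) d = 0) →
      ∀ᶠ t : ℝ in nhds 0, e + t • d ∈ halfspaceInter a 0 := by
    intro d hd
    have hcont : Filter.Tendsto (fun t : ℝ => t • d) (nhds 0) (nhds 0) := by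
      have : Continuous fun t : ℝ => t • d := by fun_prop
      simpa using this.tendsto 0
    filter_upwards [hcont.eventually (eventually_add_mem_halfspaceInter hep)] with t ht
    refine ht.2 fun j hj => ?_
    rw [inner_smul_right, hd j hj, mul_zero]
  have h1 := hev d hdt
  have h2 := hev (-d) fun j hj => by rw [inner_neg_right, hdt j hj, neg_zero]
  obtain ⟨t, ⟨h1, h2⟩, ht⟩ := (((h1.and h2).filter_mono nhdsWithin_le_nhds).and
    (self_mem_nhdsWithin (s := Set.Ioi (0 : ℝ)))).exists
  have hmem : ∀ d, ∑ j, inner ℝ (a j) d = 0 → e + t • d ∈ halfspaceInter a 0 → e + t • d ∈ S := by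
    intro d hd h
    refine ⟨h, ?_⟩
    simp only [inner_add_right, inner_smul_right, Finset.sum_add_distrib, ← Finset.mul_sum, hd,
      heS1.2]
    ring
  have := hext _ (hmem d hdsum h1) _ (hmem (-d) (by simp [hdsum]) h2)
    ⟨1/2, 1/2, by norm_num, by norm_num, by norm_num, by module⟩
  have hd0 : d = 0 := by simpa [(show (0 : ℝ) < t from ht).ne'] using this
  exact sub_eq_zero.1 hd0

/-- If a nonzero feasible direction at a vertex `v` does not decrease `⟪u, ·⟫`, then neither does
some edge at `v`. -/
lemma exists_nondecreasing_edge [FiniteDimensional ℝ E] [Finite κ]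
    (hbdd : Bornology.IsBounded (halfspaceInter a b)) (hv : v ∈ halfspaceInter a b)
    (hvert : IsExposed ℝ (halfspaceInter a b) {v}) {u c : E} (hc : c ∈ feasibleCone a b v)
    (hc0 : c ≠ 0) (huc : 0 ≤ inner ℝ u c) :
    ∃ y, y ≠ v ∧ IsExposed ℝ (halfspaceInter a b) {y} ∧
      IsExposed ℝ (halfspaceInter a b) (segment ℝ v y) ∧ inner ℝ u v ≤ inner ℝ u y := by
  have hker := (isExposed_singleton_iff hv).1 hvert
  obtain ⟨e, he0, hecone, hue, hline⟩ := exists_extreme_ray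
    (a := fun j : {j // inner ℝ (a j) v = b j} => a j)
    (fun w hw => hker w fun j hj => hw ⟨j, hj⟩) (fun j => hc j j.2) hc0 huc
  have he : e ∈ feasibleCone a b v := fun j hj => hecone ⟨j, hj⟩
  have hline' : ∀ w, (∀ j, inner ℝ (a j) v = b j → inner ℝ (a j) e = 0 → inner ℝ (a j) w = 0) →
      ∃ s : ℝ, w = s • e := fun w hw => hline w fun j => hw j j.2
  have hlineemb : Topology.IsClosedEmbedding fun t : ℝ => v + t • e :=
    (Homeomorph.addLeft v).isClosedEmbedding.comp (isClosedEmbedding_smul_left he0)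
  have hcomp : IsCompact ((fun t : ℝ => v + t • e) ⁻¹' halfspaceInter a b) :=
    hlineemb.isCompact_preimage (Metric.isCompact_of_isClosed_isBounded isClosed_halfspaceInter hbdd)
  obtain ⟨t₀, ht₀, ht₀P⟩ := exists_pos_add_smul_mem hv he
  -- The far endpoint of the edge is the last point of the ray `v + t • e` in the polytope.
  obtain ⟨t, htP, htmax⟩ := hcomp.exists_isMaxOn ⟨t₀, ht₀P⟩ continuousOn_id
  have htmax : ∀ s : ℝ, v + s • e ∈ halfspaceInter a b → s ≤ t := fun s hs => htmax hs
  have ht : 0 < t := ht₀.trans_le (htmax _ ht₀P)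
  change v + t • e ∈ halfspaceInter a b at htP
  refine ⟨v + t • e, by simp [ht.ne', he0], ?_, ?_, ?_⟩
  · refine (isExposed_singleton_iff htP).2 fun w hw => ?_
    obtain ⟨s, rfl⟩ := hline' w fun j hj hje => hw j (by
      rw [inner_add_right, inner_smul_right, hje, hj, mul_zero, add_zero])
    by_contra hs
    have hs0 : s ≠ 0 := fun h => hs (by rw [h, zero_smul])
    obtain ⟨ε, hε, hεP⟩ := exists_pos_add_smul_mem htP (c := e) fun j hj => by
      have := hw j hj
      rw [inner_smul_right] at this
      exact ((mul_eq_zero.1 this).resolve_left hs0).le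
    rw [add_assoc, ← add_smul] at hεP
    linarith [htmax _ hεP]
  · convert isExposed_tight (a := a) (b := b) {j | inner ℝ (a j) v = b j ∧ inner ℝ (a j) e = 0}
    rw [segment_eq_image']
    ext x
    constructor
    · rintro ⟨θ, ⟨h0, h1⟩, rfl⟩
      rw [add_sub_cancel_left]
      refine ⟨fun j => ?_, fun j hj => ?_⟩
      · have h2 := hv j
        have h3 := htP j
        simp only [inner_add_right, inner_smul_right] at h3 ⊢
        nlinarith
      · simp only [inner_add_right, inner_smul_right, hj.1, hj.2]
        ring
    · rintro ⟨hx, hxt⟩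
      obtain ⟨s, hs⟩ := hline' (x - v) fun j hj hje => by
        rw [inner_sub_right, hxt j ⟨hj, hje⟩, hj, sub_self]
      obtain rfl : x = v + s • e := by rw [← hs]; abel
      have hst := htmax s hx
      -- If `s < 0`, then `-e` is feasible as well, contradicting that the cone at a vertex contains
      -- no line.
      have hs0 : 0 ≤ s := by
        by_contra! hs0
        refine he0 (hker e fun j hj => le_antisymm (he j hj) ?_)
        have := hx j
        rw [inner_add_right, inner_smul_right] at this
        nlinarith
      refine ⟨s / t, ⟨by positivity, (div_le_one ht).2 hst⟩, ?_⟩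
      beta_reduce
      rw [add_sub_cancel_left, smul_smul, div_mul_cancel₀ _ ht.ne']
  · rw [inner_add_right, inner_smul_right]
    nlinarith [mul_nonneg ht.le hue]

end Polyhedra

/-! ### Sums of periodic functions that vanish far out in a halfspace of directions. -/

section PeriodicFunctions

open MeasureTheory

variable {E : Type*} [NormedAddCommGroup E] [InnerProductSpace ℝ E] [MeasurableSpace E]
  [BorelSpace E] {μ : Measure E} [μ.IsAddHaarMeasure]

/-- A function vanishes far out in every direction that does not decrease `⟪u, ·⟫`. -/
def VanishesAbove (u : E) (g : E → ℝ) : Prop :=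
  ∀ x w : E, w ≠ 0 → 0 ≤ inner ℝ u w → ∀ᶠ k : ℕ in Filter.atTop, g (x + (k : ℝ) • w) = 0

lemma VanishesAbove.ae_eq_zero_of_periodic {u w : E} {g : E → ℝ} (hg : VanishesAbove u g)
    (hw : w ≠ 0) (huw : 0 ≤ inner ℝ u w) (hper : ∀ᵐ x ∂μ, g (x + w) = g x) :
    ∀ᵐ x ∂μ, g x = 0 := by
  have h : ∀ᵐ x ∂μ, ∀ k : ℕ, g (x + (k : ℝ) • w + w) = g (x + (k : ℝ) • w) :=
    ae_all_iff.2 fun k => (measurePreserving_add_right μ ((k : ℝ) • w)).quasiMeasurePreserving.ae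
      hper
  filter_upwards [h] with x hx
  have hk : ∀ k : ℕ, g (x + (k : ℝ) • w) = g x := by
    intro k
    induction k with
    | zero => simp
    | succ k ih =>
      rw [← ih, ← hx k]
      congr 1
      push_cast
      module
  obtain ⟨k, hk'⟩ := (hg x w hw huw).exists
  rw [← hk k, hk']

/-- Induction on `S`: the difference of `g` along `w s` loses the term `h s` and the constant, and
keeps the other periods. It vanishes a.e. by induction, so `g` itself is `w s`-periodic a.e. The
direction `w₀` serves the base case, where `g` is constant a.e. -/
lemma VanishesAbove.ae_eq_zero {σ : Type*} {u w₀ : E} (hw₀ : w₀ ≠ 0) (huw₀ : 0 ≤ inner ℝ u w₀)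
    (w : σ → E) (S : Finset σ) (hw : ∀ s ∈ S, w s ≠ 0 ∧ 0 ≤ inner ℝ u (w s))
    {g : E → ℝ} (hg : VanishesAbove u g) (c : ℝ) (h : σ → E → ℝ)
    (hper : ∀ s ∈ S, ∀ x, h s (x + w s) = h s x)
    (heq : ∀ᵐ x ∂μ, g x = c + ∑ s ∈ S, h s x) : ∀ᵐ x ∂μ, g x = 0 := by
  classical
  induction S using Finset.induction_on generalizing g c h with
  | empty =>
    refine hg.ae_eq_zero_of_periodic hw₀ huw₀ ?_
    filter_upwards [heq, (measurePreserving_add_right μ w₀).quasiMeasurePreserving.ae heq]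
      with x h1 h2
    rw [h1, h2]
    simp
  | insert s S hs ih =>
    have hws := hw s (Finset.mem_insert_self s S)
    refine hg.ae_eq_zero_of_periodic hws.1 hws.2 ?_
    have := ih (fun t ht => hw t (Finset.mem_insert_of_mem ht))
      (g := fun x => g (x + w s) - g x) (fun x w' hw' huw' => by
        filter_upwards [hg x w' hw' huw', hg (x + w s) w' hw' huw'] with k h1 h2
        rw [h1, add_right_comm, h2, sub_zero]) 0 (fun t x => h t (x + w s) - h t x)
      (fun t ht x => by
        have := hper t (Finset.mem_insert_of_mem ht)
        simp only [add_right_comm x (w t) (w s), this]) (by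
        filter_upwards [heq, (measurePreserving_add_right μ (w s)).quasiMeasurePreserving.ae heq]
          with x h1 h2
        rw [h1, h2, Finset.sum_insert hs, Finset.sum_insert hs,
          hper s (Finset.mem_insert_self s S), Finset.sum_sub_distrib]
        ring)
    filter_upwards [this] with x hx
    exact sub_eq_zero.1 hx

end PeriodicFunctions

/-! ### Indicators of feasible cones: vanishing and periodicity. -/

section Cones

variable {E : Type*} [NormedAddCommGroup E] [InnerProductSpace ℝ E]
  {κ : Type*} {a : κ → E} {b : κ → ℝ} {v : E}

/-- Such a direction lies outside the cone, so some tight inequality is violated linearly as `k`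
grows. -/
lemma vanishesAbove_indicator_feasibleCone {u : E}
    (hu : ∀ c ∈ feasibleCone a b v, c ≠ 0 → inner ℝ u c < 0) :
    VanishesAbove u ((feasibleCone a b v).indicator 1) := by
  intro x w hw huw
  have hwC : w ∉ feasibleCone a b v := fun h => huw.not_gt (hu w h hw)
  simp only [feasibleCone, Set.mem_ofPred_eq, not_forall, not_le] at hwC
  obtain ⟨j, hj, hjw⟩ := hwC
  have ht : Filter.Tendsto (fun k : ℕ => inner ℝ (a j) x + (k : ℝ) * inner ℝ (a j) w)
      Filter.atTop Filter.atTop :=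
    Filter.tendsto_atTop_add_const_left _ _ (tendsto_natCast_atTop_atTop.atTop_mul_const hjw)
  filter_upwards [ht.eventually_gt_atTop 0] with k hk
  refine Set.indicator_of_notMem (fun h => ?_) _
  have := h j hj
  rw [inner_add_right, inner_smul_right] at this
  linarith

lemma indicator_feasibleCone_add {w : E} (hw : ∀ j, inner ℝ (a j) v = b j → inner ℝ (a j) w = 0)
    (x : E) : (feasibleCone a b v).indicator (1 : E → ℝ) (x + w) =
      (feasibleCone a b v).indicator 1 x := by
  have : x + w ∈ feasibleCone a b v ↔ x ∈ feasibleCone a b v :=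
    forall₂_congr fun j hj => by rw [inner_add_right, hw j hj, add_zero]
  by_cases hx : x ∈ feasibleCone a b v
  · rw [Set.indicator_of_mem (this.2 hx), Set.indicator_of_mem hx]
    rfl
  · rw [Set.indicator_of_notMem (mt this.1 hx), Set.indicator_of_notMem hx]

end Cones

/-! ### Passing from interiors of feasible cones to interiors of polyhedra. -/

section LocalStructure

variable {E : Type*} [NormedAddCommGroup E] [InnerProductSpace ℝ E]
  {κ : Type*} {a : κ → E} {b : κ → ℝ} {v : E}

lemma tendsto_smul_nhdsGT_zero (x : E) :
    Filter.Tendsto (fun t : ℝ => t • x) (nhdsWithin 0 (Set.Ioi 0)) (nhds 0) := by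
  have : Continuous fun t : ℝ => t • x := by fun_prop
  simpa using (this.tendsto 0).mono_left nhdsWithin_le_nhds

lemma eventually_add_smul_mem_interior [Finite κ] (hv : v ∈ halfspaceInter a b) {x : E}
    (hx : x ∈ interior (feasibleCone a b v)) :
    ∀ᶠ t : ℝ in nhdsWithin 0 (Set.Ioi 0), v + t • x ∈ interior (halfspaceInter a b) := by
  filter_upwards [(tendsto_smul_nhdsGT_zero x).eventually
    (eventually_add_mem_halfspaceInter hv).eventually_nhds, self_mem_nhdsWithin] with t ht ht0
  have ht0 : 0 < t := ht0
  have h1 : ∀ᶠ c in nhds (t • x), c ∈ feasibleCone a b v := by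
    have hc : Filter.Tendsto (fun c : E => t⁻¹ • c) (nhds (t • x)) (nhds x) := by
      have : Continuous fun c : E => t⁻¹ • c := by fun_prop
      simpa [smul_smul, ht0.ne'] using this.tendsto (t • x)
    filter_upwards [hc.eventually (mem_interior_iff_mem_nhds.1 hx)] with c hc
    exact (smul_mem_feasibleCone_iff (inv_pos.2 ht0)).1 hc
  have h2 : ∀ᶠ c in nhds (t • x), v + c ∈ halfspaceInter a b := by
    filter_upwards [ht, h1] with c hc hc' using hc.2 hc'
  have h3 : Filter.Tendsto (fun y : E => y - v) (nhds (v + t • x)) (nhds (t • x)) := by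
    have : Continuous fun y : E => y - v := by fun_prop
    simpa using this.tendsto (v + t • x)
  refine mem_interior_iff_mem_nhds.2 ?_
  filter_upwards [h3.eventually h2] with y hy
  simpa using hy

end LocalStructure

/-! ### The cones at a vertex of the tiling and the nondecreasing edge. -/

section Tilings

variable {n : ℕ} {ι : Type*} {T : ι → Set (EuclideanSpace ℝ (Fin n))}

lemma eventually_exists_tile_of_mem (hT : IsPolytopalTiling T) (hfin : IsLocallyFiniteTiling T)
    (hclosed : ∀ i, IsClosed (T i)) (v : EuclideanSpace ℝ (Fin n)) :
    ∀ᶠ x in nhds v, ∃ i, v ∈ T i ∧ x ∈ T i := by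
  have hF := hfin _ (Metric.isBounded_ball (x := v) (r := 1))
  have h : ∀ᶠ x in nhds v, ∀ i ∈ {i | (T i ∩ Metric.ball v 1).Nonempty}, v ∉ T i → x ∉ T i := by
    refine (Filter.eventually_all_finite hF).2 fun i _ => ?_
    by_cases hi : v ∈ T i
    · exact Filter.Eventually.of_forall fun x h => absurd hi h
    · filter_upwards [(hclosed i).isOpen_compl.mem_nhds hi] with x hx _ using hx
  filter_upwards [h, Metric.ball_mem_nhds v one_pos] with x hx hxb
  obtain ⟨i, hi⟩ := Set.mem_iUnion.1 (hT.covering.symm ▸ Set.mem_univ x : x ∈ ⋃ i, T i)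
  by_contra! hcon
  exact hx i ⟨x, hi, hxb⟩ (fun hv => hcon i hv hi) hi

/-- Around every vertex `v` and for every linear functional, some tile with vertex `v` has an edge
at `v` along which the functional does not decrease. -/
lemma exists_nondecreasing_tiling_edge (hn : 1 ≤ n) (hT : IsPolytopalTiling T)
    (hfin : IsLocallyFiniteTiling T) {v : EuclideanSpace ℝ (Fin n)} (hv : v ∈ tilingVertices T)
    (u : EuclideanSpace ℝ (Fin n)) :
    ∃ i y, IsVertexOf (T i) y ∧ IsEdgeOf (T i) v y ∧ inner ℝ u v ≤ inner ℝ u y := by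
  classical
  by_contra! hcon
  choose m a b _ hP using fun i => (hT.polytope i).1
  replace hP : ∀ i, T i = halfspaceInter (a i) (b i) := hP
  have hclosed : ∀ i, IsClosed (T i) := fun i => hP i ▸ isClosed_halfspaceInter
  set C := fun i => feasibleCone (a i) (b i) v with hC
  have hIfin : {i | v ∈ T i}.Finite :=
    (hfin {v} Bornology.isBounded_singleton).subset fun i hi => ⟨v, hi, rfl⟩
  set I := hIfin.toFinset with hI
  have hmemI : ∀ i, i ∈ I ↔ v ∈ halfspaceInter (a i) (b i) := fun i => by simp [hI, hP i]
  have hpointed : ∀ i ∈ I, IsVertexOf (T i) v → ∀ c ∈ C i, c ≠ 0 → inner ℝ u c < 0 := by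
    intro i hi hvi c hc hc0
    by_contra! huc
    obtain ⟨y, hyv, hy, hedge, huy⟩ := exists_nondecreasing_edge
      (hP i ▸ (hT.polytope i).2) ((hmemI i).1 hi) (hP i ▸ hvi) hc hc0 huc
    rw [← hP i] at hy hedge
    exact (hcon i y hy ⟨hyv.symm, hedge⟩).not_ge huy
  -- Where `v` is not a vertex, the tight normals do not span; the sign of the line direction is
  -- free. The value 0 fills the irrelevant cases.
  have hline : ∀ i, ∃ w, i ∈ I → ¬ IsVertexOf (T i) v → (w ≠ 0 ∧ 0 ≤ inner ℝ u w) ∧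
      ∀ j, inner ℝ (a i j) v = b i j → inner ℝ (a i j) w = 0 := by
    intro i
    by_cases hi : i ∈ I
    · by_cases hvi : IsVertexOf (T i) v
      · exact ⟨0, fun _ h => absurd hvi h⟩
      · have := (isExposed_singleton_iff ((hmemI i).1 hi)).not.1 (hP i ▸ hvi)
        push Not at this
        obtain ⟨w, hw, hw0⟩ := this
        rcases le_total 0 (inner ℝ u w) with h | h
        · exact ⟨w, fun _ _ => ⟨⟨hw0, h⟩, hw⟩⟩
        · exact ⟨-w, fun _ _ => ⟨⟨neg_ne_zero.2 hw0, by rwa [inner_neg_right, neg_nonneg]⟩,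
            fun j hj => by rw [inner_neg_right, hw j hj, neg_zero]⟩⟩
    · exact ⟨0, fun h => absurd h hi⟩
  choose w hw using hline
  have hcover : ∀ x, ∃ i ∈ I, x ∈ C i := by
    intro x
    have h1 : Filter.Tendsto (fun t : ℝ => v + t • x) (nhdsWithin 0 (Set.Ioi 0)) (nhds v) := by
      simpa using (tendsto_smul_nhdsGT_zero x).const_add v
    obtain ⟨t, ⟨i, hvi, hi⟩, ht⟩ := ((h1.eventually
      (eventually_exists_tile_of_mem hT hfin hclosed v)).and self_mem_nhdsWithin).exists
    rw [hP i] at hvi hi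
    exact ⟨i, (hmemI i).2 hvi, (smul_mem_feasibleCone_iff ht).1 (mem_feasibleCone_of_add_mem hi)⟩
  have hdisj : ∀ i ∈ I, ∀ j ∈ I, ∀ x ∈ interior (C i), x ∈ interior (C j) → i = j := by
    intro i hi j hj x hxi hxj
    by_contra hij
    obtain ⟨t, h1, h2⟩ := ((eventually_add_smul_mem_interior ((hmemI i).1 hi) hxi).and
      (eventually_add_smul_mem_interior ((hmemI j).1 hj) hxj)).exists
    rw [← hP] at h1 h2
    exact Set.disjoint_left.1 (hT.packing hij) h1 h2
  -- The cones cover and have disjoint interiors; convexity makes their frontiers null.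
  have hsum : ∀ᵐ x, ∑ i ∈ I, (C i).indicator (1 : EuclideanSpace ℝ (Fin n) → ℝ) x = 1 := by
    have hfr : ∀ᵐ x, ∀ i ∈ I, x ∉ frontier (C i) :=
      (MeasureTheory.ae_ball_iff I.countable_toSet).2 fun i _ =>
        MeasureTheory.measure_eq_zero_iff_ae_notMem.1
          (convex_feasibleCone.addHaar_frontier MeasureTheory.volume)
    filter_upwards [hfr] with x hx
    have hint : ∀ i ∈ I, x ∈ C i → x ∈ interior (C i) := fun i hi hxi => by
      by_contra h
      exact hx i hi ⟨subset_closure hxi, h⟩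
    obtain ⟨i, hi, hxi⟩ := hcover x
    rw [Finset.sum_eq_single_of_mem i hi, Set.indicator_of_mem hxi, Pi.one_apply]
    intro j hj hji
    exact Set.indicator_of_notMem (fun hxj =>
      hji (hdisj j hj i hi x (hint j hj hxj) (hint i hi hxi))) _
  set F := I.filter fun i => IsVertexOf (T i) v with hF
  set N := I.filter fun i => ¬ IsVertexOf (T i) v with hN
  set g : EuclideanSpace ℝ (Fin n) → ℝ := fun x => ∑ i ∈ F, (C i).indicator 1 x with hg
  have hgv : VanishesAbove u g := by
    intro x w hw huw
    have : ∀ᶠ k : ℕ in Filter.atTop, ∀ i ∈ F,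
        (C i).indicator (1 : EuclideanSpace ℝ (Fin n) → ℝ) (x + (k : ℝ) • w) = 0 :=
      (Filter.eventually_all_finset F).2 fun i hi =>
        vanishesAbove_indicator_feasibleCone
          (hpointed i (Finset.mem_filter.1 hi).1 (Finset.mem_filter.1 hi).2) x w hw huw
    filter_upwards [this] with k hk using Finset.sum_eq_zero hk
  have hwN : ∀ i ∈ N, _ := fun i hi =>
    hw i (Finset.mem_filter.1 hi).1 (Finset.mem_filter.1 hi).2
  obtain ⟨w₀, hw₀, huw₀⟩ : ∃ w : EuclideanSpace ℝ (Fin n), w ≠ 0 ∧ 0 ≤ inner ℝ u w := by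
    have : NeZero n := ⟨by omega⟩
    obtain ⟨w, hw⟩ := exists_ne (0 : EuclideanSpace ℝ (Fin n))
    rcases le_total 0 (inner ℝ u w) with h | h
    · exact ⟨w, hw, h⟩
    · exact ⟨-w, neg_ne_zero.2 hw, by rwa [inner_neg_right, neg_nonneg]⟩
  have hzero : ∀ᵐ x, g x = 0 := by
    refine hgv.ae_eq_zero hw₀ huw₀ w N (fun i hi => (hwN i hi).1) 1
      (fun i x => -(C i).indicator 1 x)
      (fun i hi x => by rw [indicator_feasibleCone_add (hwN i hi).2]) ?_
    filter_upwards [hsum] with x hx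
    rw [← Finset.sum_filter_add_sum_filter_not I fun i => IsVertexOf (T i) v] at hx
    rw [Finset.sum_neg_distrib]
    linarith
  obtain ⟨i, hi⟩ := hv
  have hiI : i ∈ I := by
    rw [hmemI, ← hP]
    exact (IsExposed.subset hi) rfl
  have hopen : IsOpen ((fun x => v + x) ⁻¹' interior (T i)) :=
    isOpen_interior.preimage (by fun_prop)
  obtain ⟨p, hp⟩ := hT.full_dim i
  have hpos := hopen.measure_pos MeasureTheory.volume ⟨p - v, by simpa using hp⟩
  -- The tile having `v` as a vertex, translated by `-v`, lies in its cone, where `g ≥ 1`.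
  refine hpos.ne' (MeasureTheory.measure_mono_null (fun x hx => ?_) (MeasureTheory.ae_iff.1 hzero))
  have hxC : x ∈ C i := mem_feasibleCone_of_add_mem (hP i ▸ interior_subset hx)
  have h1 := Finset.single_le_sum (s := F)
    (f := fun i => (C i).indicator (1 : EuclideanSpace ℝ (Fin n) → ℝ) x)
    (fun j _ => Set.indicator_nonneg (fun _ _ => zero_le_one) x)
    (Finset.mem_filter.2 ⟨hiI, hi⟩)
  simp only [Set.indicator_of_mem hxC, Pi.one_apply] at h1
  exact (zero_lt_one.trans_le h1).ne'

lemma exists_adj_inner_le (hn : 1 ≤ n) (hT : IsPolytopalTiling T)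
    (hfin : IsLocallyFiniteTiling T) (v : tilingVertices T) (u : EuclideanSpace ℝ (Fin n)) :
    ∃ y, (tilingGraph T).Adj v y ∧
      inner ℝ u (v : EuclideanSpace ℝ (Fin n)) ≤ inner ℝ u (y : EuclideanSpace ℝ (Fin n)) := by
  obtain ⟨i, y, hy, hedge, hvy⟩ := exists_nondecreasing_tiling_edge hn hT hfin v.2 u
  exact ⟨⟨y, i, hy⟩, ⟨i, hedge⟩, hvy⟩

end Tilings

lemma eq_of_norm_le_of_inner_self_le {E : Type*} [NormedAddCommGroup E] [InnerProductSpace ℝ E]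
    {v y : E} (hnorm : ‖y‖ ≤ ‖v‖) (hvy : inner ℝ v v ≤ inner ℝ v y) : v = y := by
  have h1 := norm_sub_sq_real v y
  rw [real_inner_self_eq_norm_sq] at hvy
  have h2 : ‖y‖ ^ 2 ≤ ‖v‖ ^ 2 := pow_le_pow_left₀ (norm_nonneg y) hnorm 2
  have h3 : ‖v - y‖ ^ 2 = 0 := le_antisymm (by linarith) (sq_nonneg _)
  exact sub_eq_zero.1 (norm_eq_zero.1 (pow_eq_zero_iff two_ne_zero |>.1 h3))

theorem mainTheorem5 {n : ℕ} (hn : 1 ≤ n) {ι : Type*}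
    (T : ι → Set (EuclideanSpace ℝ (Fin n)))
    (hT : IsPolytopalTiling T) (hfin : IsLocallyFiniteTiling T)
    (C : (tilingGraph T).ConnectedComponent) :
    C.supp.Infinite := by
  intro hCfin
  obtain ⟨v, hvC, hvmax⟩ := Set.exists_max_image C.supp
    (fun x : tilingVertices T => ‖(x : EuclideanSpace ℝ (Fin n))‖) hCfin C.nonempty_supp
  obtain ⟨y, hadj, hvy⟩ := exists_adj_inner_le hn hT hfin v v
  have hyC : y ∈ C.supp := (C.mem_supp_congr_adj hadj).1 hvC
  exact hadj.ne (Subtype.ext (eq_of_norm_le_of_inner_self_le (hvmax y hyC) hvy))
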